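/- **Setting.** Let $N\ge 1$ be an integer and $\alpha,\beta>-1$. For $a,b\in\mathbb R$ let $P_n^{(a,b)}$ be the Jacobi polynomial in Szegő's normalization, $$P_n^{(a,b)}(x)=\frac1{n!}\sum_{k=0}^n\binom nk (n+a+b+1)_k\,(a+k+1)_{n-k}\Big(\frac{x-1}2\Big)^k ,$$ where $(c)_k=c(c+1)\cdots(c+k-1)$, and let $P_n=P_n^{(0,0)}$ be the Legendre polynomial. For $a,b>-1$ put $\omega^{(a,b)}(x)=(1-x)^a(1+x)^b$ and $$\gamma_n^{(a,b)}=\frac{2^{a+b+1}\Gamma(n+a+1)\Gamma(n+b+1)}{(2n+a+b+1)\,n!\,\Gamma(n+a+b+1)}$$ (for $n=0$ read $(a+b+1)\Gamma(a+b+1)$ as $\Gamma(a+b+2)$), and define the connection coefficients from $\{P_n^{(c,d)}\}$ to $\{P_l^{(a,b)}\}$, where $c,d>-1$, by $${}^{(c,d)}C^{(a,b)}_{l,n}=\frac1{\gamma_l^{(a,b)}}\int_{-1}^1P_l^{(a,b)}(x)P_n^{(c,d)}(x)\,\omega^{(a,b)}(x)\,dx\qquad(l,n\ge 0).$$ Let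 $-1=x_0<x_1<\dots<x_N=1$ be the Jacobi-Gauss-Lobatto points, that is, the zeros of $(1-x^2)\frac{d}{dx}P_N^{(\alpha,\beta)}(x)$ in ascending order, let $h_0,\dots,h_N$ be the Lagrange basis polynomials at these points ($\deg h_j\le N$, $h_j(x_i)=\delta_{ij}$), and let $\omega_j=\int_{-1}^1h_j(x)\,\omega^{(\alpha,\beta)}(x)\,dx$ be the corresponding quadrature weights. For $1\le n\le N$ and $0\le j\le N$ put $$t_{nj}=\frac{\omega_j}{\tilde\gamma_n^{(\alpha,\beta)}}P_n^{(\alpha,\beta)}(x_j),\qquad \tilde\gamma_n^{(\alpha,\beta)}=\gamma_n^{(\alpha,\beta)}\ (n<N),\qquad \tilde\gamma_N^{(\alpha,\beta)}=\Big(2+\frac{\alpha+\beta+1}N\Big)\gamma_N^{(\alpha,\beta)},$$ and for $1\le l\le N$, $0\le j\le N$ put $$s_{lj}=\frac12\sum_{n=\max(1,\,l-1)}^N(n+\alpha+\beta+1)\;{}^{(\alpha+1,\beta+1)}C^{(0,0)}_{l-1,\,n-1}\;t_{nj}.$$ For $\mu\in(0,1)$ the Caputo fractional pseudospectral differentiation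 matrix ${}^C\!\boldsymbol D^{(\mu)}\in\mathbb R^{(N+1)\times(N+1)}$ has the entries $${}^C\!\boldsymbol D^{(\mu)}_{ij}=\frac1{\Gamma(1-\mu)}\int_{-1}^{x_i}\frac{h_j'(y)}{(x_i-y)^{\mu}}\,dy ,\qquad 0\le i,j\le N .$$ **Theorem.** (1) For every $\mu\in(0,1)$ and all $0\le i,j\le N$, $${}^C\!\boldsymbol D^{(\mu)}_{ij}=(1+x_i)^{1-\mu}\sum_{l=1}^N\frac{(l-1)!}{\Gamma(l+1-\mu)}\,s_{lj}\,P_{l-1}^{(\mu-1,\,1-\mu)}(x_i).$$ (2) If $\alpha=\beta=0$, then for $1\le l\le N$ and $0\le j\le N$, $$s_{lj}=\frac1{\gamma_{l-1}}\Big\{\delta_{jN}+(-1)^l\delta_{j0}-\omega_jP_{l-1}'(x_j)\Big\},\qquad \gamma_{l-1}=\frac2{2l-1}.$$ -/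

import Mathlib

noncomputable section

/-- The Jacobi polynomial `P_n^{(α,β)}` in Szego's normalization,
`Γ(n+α+1) / (n! Γ(α+1)) * ₂F₁(-n, n+α+β+1; α+1; (1-x)/2)`, written as the finite sum
`(1/n!) ∑_k (n choose k) (n+α+β+1)_k (α+k+1)_{n-k} ((x-1)/2)^k` with rising factorials, which is
meaningful for all real `α, β`. -/
def jacobiPoly (α β : ℝ) (n : ℕ) : Polynomial ℝ :=
  ∑ k ∈ Finset.range (n + 1),
    Polynomial.C ((n.choose k : ℝ) * (ascPochhammer ℝ k).eval (n + α + β + 1)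
      * (ascPochhammer ℝ (n - k)).eval (α + k + 1) / (n.factorial : ℝ))
    * (Polynomial.C (1 / 2) * (Polynomial.X - 1)) ^ k

/-- The Jacobi weight function `ω^{(α,β)}(x) = (1-x)^α (1+x)^β` on `(-1,1)`. -/
def jacobiWeight (α β x : ℝ) : ℝ := (1 - x) ^ α * (1 + x) ^ β

/-- The normalization constant `γ_n^{(α,β)}` of the Jacobi polynomials. For `n = 0` the product
`(α+β+1) Γ(α+β+1)` is written as `Γ(α+β+2)`, so that the case `α + β = -1` is covered. -/
def jacobiGamma (α β : ℝ) (n : ℕ) : ℝ :=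
  if n = 0 then
    2 ^ (α + β + 1) * Real.Gamma (α + 1) * Real.Gamma (β + 1) / Real.Gamma (α + β + 2)
  else
    2 ^ (α + β + 1) * Real.Gamma (n + α + 1) * Real.Gamma (n + β + 1)
      / ((2 * n + α + β + 1) * (n.factorial : ℝ) * Real.Gamma (n + α + β + 1))

/-- The modified constants: `γ_n^{(α,β)}` for `n ≠ N`, and
`(2 + (α+β+1)/N) γ_N^{(α,β)}` for `n = N`. -/
def jacobiGammaTilde (α β : ℝ) (N n : ℕ) : ℝ :=
  if n = N then (2 + (α + β + 1) / N) * jacobiGamma α β N else jacobiGamma α β n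

/-- The connection coefficient `C_{ln}` of the transform from `P_n^{(α,β)}` to `P_l^{(a,b)}`. -/
def jacobiConnection (α β a b : ℝ) (l n : ℕ) : ℝ :=
  1 / jacobiGamma a b l *
    ∫ x in (-1 : ℝ)..1,
      (jacobiPoly a b l).eval x * (jacobiPoly α β n).eval x * jacobiWeight a b x

/-- `x_0 < x_1 < ⋯ < x_N` are the Jacobi-Gauss-Lobatto points: the zeros of
`(1 - x^2) (d/dx) P_N^{(α,β)}(x)`, in ascending order. -/
def IsJGLPoints {N : ℕ} (α β : ℝ) (x : Fin (N + 1) → ℝ) : Prop :=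
  StrictMono x ∧
    Set.range x =
      {y : ℝ | (1 - y ^ 2) * (Polynomial.derivative (jacobiPoly α β N)).eval y = 0}

/-- The Lagrange basis polynomial `h_j` at the points `x_0, …, x_N`. -/
def lagrangeBasis {N : ℕ} (x : Fin (N + 1) → ℝ) (j : Fin (N + 1)) : Polynomial ℝ :=
  Lagrange.basis Finset.univ x j

/-- The weights of the interpolatory quadrature at the points `x_0, …, x_N` for the Jacobi weight:
`ω_j = ∫_{-1}^1 h_j(y) ω^{(α,β)}(y) dy`. -/
def quadratureWeight {N : ℕ} (α β : ℝ) (x : Fin (N + 1) → ℝ) (j : Fin (N + 1)) : ℝ :=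
  ∫ y in (-1 : ℝ)..1, (lagrangeBasis x j).eval y * jacobiWeight α β y

/-- The left-sided fractional integral of order `ρ > 0` with base point `a`. -/
def fracIntegral (a ρ : ℝ) (u : ℝ → ℝ) (x : ℝ) : ℝ :=
  1 / Real.Gamma ρ * ∫ y in a..x, u y / (x - y) ^ (1 - ρ)

/-- The left-sided Caputo derivative of order `μ` with base point `a`: with `k = ⌈μ⌉` it is the
fractional integral of order `k - μ` of the `k`-th derivative, and it is the `k`-th derivative
itself if `μ = k` is an integer. -/
def caputoDeriv (a μ : ℝ) (u : ℝ → ℝ) (x : ℝ) : ℝ :=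
  if μ = (⌈μ⌉₊ : ℝ) then iteratedDeriv ⌈μ⌉₊ u x
  else fracIntegral a ((⌈μ⌉₊ : ℝ) - μ) (iteratedDeriv ⌈μ⌉₊ u) x

/-- The Caputo fractional pseudospectral differentiation matrix of order `μ` on `(-1,1)`: its
`(i,j)` entry is the Caputo derivative of `h_j`, with base point `-1`, at `x_i`. -/
def caputoMatrix {N : ℕ} (μ : ℝ) (x : Fin (N + 1) → ℝ) :
    Matrix (Fin (N + 1)) (Fin (N + 1)) ℝ :=
  Matrix.of fun i j => caputoDeriv (-1) μ (fun y => (lagrangeBasis x j).eval y) (x i)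

/-- `t_{nj} = ω_j P_n^{(α,β)}(x_j) / γ̃_n^{(α,β)}`. -/
def tCoeff {N : ℕ} (α β : ℝ) (x : Fin (N + 1) → ℝ) (n : ℕ) (j : Fin (N + 1)) : ℝ :=
  quadratureWeight α β x j / jacobiGammaTilde α β N n * (jacobiPoly α β n).eval (x j)

/-- `s_{lj} = (1/2) ∑_{n=l-1}^N (n+α+β+1) C_{l-1,n-1} t_{nj}` for `1 ≤ l ≤ N`, where `C` is the
connection matrix from `P^{(α+1,β+1)}` to the Legendre polynomials `P^{(0,0)}`; there is no
term with `n = 0`, for which the index `n - 1` would be `-1`. -/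
def sCoeff {N : ℕ} (α β : ℝ) (x : Fin (N + 1) → ℝ) (l : ℕ) (j : Fin (N + 1)) : ℝ :=
  1 / 2 * ∑ n ∈ Finset.Icc (max 1 (l - 1)) N,
    (n + α + β + 1) * jacobiConnection (α + 1) (β + 1) 0 0 (l - 1) (n - 1) * tCoeff α β x n j

end

open Polynomial MeasureTheory intervalIntegral Set

/-! Both parts rest on one fact: $s_{lj}$ is the Legendre coefficient of order $l-1$ of $h_j'$
(`sCoeff_eq`). Discrete orthogonality on the Gauss-Lobatto points gives $h_j=\sum_n
t_{nj}P_n^{(\alpha,\beta)}$; differentiation turns this into a sum of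
$P_{n-1}^{(\alpha+1,\beta+1)}$, and the connection coefficients re-expand it in Legendre
polynomials.

For (1), integrate the Legendre expansion of $h_j'$ termwise against $(x_i-y)^{-\mu}$. In powers of
$1+y$ each term is a Beta integral, and the result is again a Jacobi polynomial
(`integral_jacobiPoly_div_sub_rpow`). For (2), integrate $\int P_{l-1}h_j'$ by parts: the endpoints
give the two deltas, and the remaining integral equals its quadrature sum, where only the node $x_j$
contributes.

The orthogonality theory comes from two algebraic relations, the derivative formula and its adjoint,
the lowering relation. With the divergence identity for the weight they give
`jacobiIntegral_succ_mul`, which trades $P_{n+1}^{(a,b)}$ for $P_n^{(a+1,b+1)}$ and a derivative on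
the other factor. Orthogonality, norms and exactness of the quadrature follow by induction or
division. -/

/-- The Jacobi polynomial in the variable `y = (x - 1) / 2`. -/
noncomputable def jacobiShifted (a b : ℝ) (n : ℕ) : Polynomial ℝ :=
  ∑ k ∈ Finset.range (n + 1),
    C ((n.choose k : ℝ) * (ascPochhammer ℝ k).eval (n + a + b + 1)
      * (ascPochhammer ℝ (n - k)).eval (a + k + 1) / (n.factorial : ℝ)) * X ^ k

/-! ### Algebra of Jacobi polynomials: coefficients, derivative, lowering relation, reflection -/

theorem jacobiPoly_eq_comp (a b : ℝ) (n : ℕ) :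
    jacobiPoly a b n = (jacobiShifted a b n).comp (C (1 / 2) * (X - 1)) := by
  exact Polynomial.funext fun x => by simp [jacobiPoly, jacobiShifted, eval_finsetSum]

theorem eval_jacobiPoly_eq (a b : ℝ) (n : ℕ) (x : ℝ) :
    (jacobiPoly a b n).eval x = (jacobiShifted a b n).eval (1 / 2 * (x - 1)) := by
  simp [jacobiPoly_eq_comp]

theorem coeff_jacobiShifted (a b : ℝ) (n k : ℕ) :
    (jacobiShifted a b n).coeff k = (n.choose k : ℝ) * (ascPochhammer ℝ k).eval (n + a + b + 1)
      * (ascPochhammer ℝ (n - k)).eval (a + k + 1) / (n.factorial : ℝ) := by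
  simp only [jacobiShifted, finsetSum_coeff, coeff_C_mul, coeff_X_pow]
  by_cases hk : k < n + 1
  · rw [Finset.sum_eq_single_of_mem k (Finset.mem_range.2 hk)]
    · simp
    · intro i _ hi
      simp [Ne.symm hi]
  · rw [Finset.sum_eq_zero, Nat.choose_eq_zero_of_lt (by omega)]
    · simp
    · intro i hi
      rw [if_neg, mul_zero]
      rintro rfl
      exact hk (Finset.mem_range.1 hi)

theorem ascPochhammer_eval_succ_left (k : ℕ) (s : ℝ) :
    (ascPochhammer ℝ (k + 1)).eval s = s * (ascPochhammer ℝ k).eval (s + 1) := by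
  simp [ascPochhammer_succ_left, eval_comp]

theorem jacobiPoly_zero (a b : ℝ) : jacobiPoly a b 0 = 1 := by
  simp [jacobiPoly]

/-- Coefficientwise this is $(k+1)\binom{n+1}{k+1}=(n+1)\binom nk$, with the constant $n+a+b+2$
split off as the first factor of the Pochhammer symbol. -/
theorem derivative_jacobiShifted_succ (a b : ℝ) (n : ℕ) :
    derivative (jacobiShifted a b (n + 1))
      = C (n + a + b + 2) * jacobiShifted (a + 1) (b + 1) n := by
  ext k
  rw [coeff_derivative, coeff_C_mul, coeff_jacobiShifted, coeff_jacobiShifted,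
    ascPochhammer_eval_succ_left, Nat.factorial_succ, Nat.succ_sub_succ]
  have h : ((n + 1 : ℕ).choose (k + 1) : ℝ) * (k + 1) = (n + 1) * n.choose k := by
    exact_mod_cast (Nat.add_one_mul_choose_eq n k).symm
  have e1 : ((n + 1 : ℕ) : ℝ) + a + b + 1 + 1 = n + (a + 1) + (b + 1) + 1 := by push_cast; ring
  have e2 : a + ((k + 1 : ℕ) : ℝ) + 1 = a + 1 + k + 1 := by push_cast; ring
  rw [e1, e2]
  have hn : (n : ℝ) + 1 ≠ 0 := by positivity
  push_cast
  field_simp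
  linear_combination ((n : ℝ) + 1 + a + b + 1) *
    (ascPochhammer ℝ k).eval (n + (a + 1) + (b + 1) + 1) *
    (ascPochhammer ℝ (n - k)).eval (a + 1 + k + 1) * h

theorem derivative_jacobiPoly_succ (a b : ℝ) (n : ℕ) :
    derivative (jacobiPoly a b (n + 1))
      = C ((n + a + b + 2) / 2) * jacobiPoly (a + 1) (b + 1) n := by
  rw [jacobiPoly_eq_comp, derivative_comp, derivative_jacobiShifted_succ, jacobiPoly_eq_comp]
  simp only [derivative_mul, derivative_C, derivative_sub, derivative_X, derivative_one, mul_comp,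
    C_comp, zero_mul, zero_add, sub_zero, mul_one]
  rw [← mul_assoc, ← C_mul]
  congr 2
  ring

/-- The lowering relation between `P_{n+1}^{(a,b)}` and `P_n^{(a+1,b+1)}`, in the variable
`y = (x - 1) / 2`. -/
theorem jacobiShifted_succ_eq (a b : ℝ) (n : ℕ) :
    X * derivative (jacobiShifted (a + 1) (b + 1) n)
      + X * (X * derivative (jacobiShifted (a + 1) (b + 1) n))
      + C (a + 1) * jacobiShifted (a + 1) (b + 1) n
      + C (a + b + 2) * (X * jacobiShifted (a + 1) (b + 1) n)
      = C (n + 1 : ℝ) * jacobiShifted a b (n + 1) := by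
  have hf : (n.factorial : ℝ) ≠ 0 := by positivity
  have hn : (n : ℝ) + 1 ≠ 0 := by positivity
  ext k
  rcases k with _ | k
  · simp only [coeff_add, coeff_X_mul_zero, coeff_C_mul, coeff_jacobiShifted, Nat.choose_zero_right,
      Nat.factorial_succ, Nat.sub_zero, ascPochhammer_eval_succ_left, ascPochhammer_zero, eval_one,
      Nat.cast_zero, add_zero]
    push_cast
    field_simp
    ring
  · have e1 : ((n + 1 : ℕ) : ℝ) + a + b + 1 = n + a + b + 2 := by push_cast; ring
    have e2 : (n : ℝ) + (a + 1) + (b + 1) + 1 = n + a + b + 2 + 1 := by ring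
    have e3 : a + 1 + (k : ℝ) + 1 = a + k + 2 := by ring
    have e4 : a + 1 + ((k + 1 : ℕ) : ℝ) + 1 = a + k + 2 + 1 := by push_cast; ring
    have e5 : a + ((k + 1 : ℕ) : ℝ) + 1 = a + k + 2 := by push_cast; ring
    -- $X\,d/dX$ acts on coefficients as multiplication by the index.
    have hX : (X * derivative (jacobiShifted (a + 1) (b + 1) n)).coeff k
        = k * (jacobiShifted (a + 1) (b + 1) n).coeff k := by
      rcases k with _ | k
      · simp
      · rw [coeff_X_mul, coeff_derivative]
        push_cast
        ring
    simp only [coeff_add, coeff_X_mul, coeff_C_mul, hX]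
    simp only [coeff_derivative, coeff_jacobiShifted, Nat.factorial_succ, Nat.succ_sub_succ, e1, e2,
      e3, e4, e5, ascPochhammer_eval_succ_left k (n + a + b + 2), ascPochhammer_succ_eval]
    have hc : ((n + 1).choose (k + 1) : ℝ) = n.choose k + n.choose (k + 1) := by
      exact_mod_cast Nat.choose_succ_succ n k
    have hk : ((n : ℝ) - k) * n.choose k = (k + 1) * n.choose (k + 1) := by
      rcases le_or_gt k n with h | h
      · have := Nat.choose_succ_right_eq n k
        rw [← Nat.cast_sub h]
        exact_mod_cast (by linarith)
      · rw [Nat.choose_eq_zero_of_lt h, Nat.choose_eq_zero_of_lt (by omega)]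
        simp
    -- Splitting off the first Pochhammer factor needs $k<n$; the binomial factor makes the identity
    -- hold for every $k$.
    have hp : (n.choose (k + 1) : ℝ) * ((a + k + 2) * (ascPochhammer ℝ (n - (k + 1))).eval (a + k + 2 + 1))
        = n.choose (k + 1) * (ascPochhammer ℝ (n - k)).eval (a + k + 2) := by
      rcases lt_or_ge k n with h | h
      · obtain ⟨m, rfl⟩ : ∃ m, n = k + 1 + m := ⟨n - (k + 1), by omega⟩
        rw [show k + 1 + m - k = m + 1 by omega, ascPochhammer_eval_succ_left, Nat.add_sub_cancel_left]
      · rw [Nat.choose_eq_zero_of_lt (by omega)]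
        simp
    rw [hc]
    push_cast
    field_simp
    generalize (ascPochhammer ℝ (n - (k + 1))).eval (a + k + 2 + 1) = A at *
    generalize (ascPochhammer ℝ (n - k)).eval (a + k + 2) = B at *
    generalize (ascPochhammer ℝ k).eval (n + a + b + 2 + 1) = D at *
    generalize (n.choose (k + 1) : ℝ) = u at *
    generalize (n.choose k : ℝ) = v at *
    linear_combination (n + a + b + 2 + 1 + k) * D * hp - D * B * hk

/-- The lowering relation
`(1 - x²) Q' + ((b - a) - (a + b + 2) x) Q = -2 (n + 1) P_{n+1}^{(a,b)}` with
`Q = P_n^{(a+1,b+1)}`. -/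
theorem jacobiPoly_succ_eq (a b : ℝ) (n : ℕ) :
    (1 - X ^ 2) * derivative (jacobiPoly (a + 1) (b + 1) n)
      + (C (b - a) - C (a + b + 2) * X) * jacobiPoly (a + 1) (b + 1) n
      = C (-2 * (n + 1 : ℝ)) * jacobiPoly a b (n + 1) := by
  refine Polynomial.funext fun x => ?_
  have h := congrArg (eval (1 / 2 * (x - 1))) (jacobiShifted_succ_eq a b n)
  simp only [eval_add, eval_mul, eval_X, eval_C] at h
  rw [jacobiPoly_eq_comp, jacobiPoly_eq_comp, derivative_comp]
  simp only [derivative_mul, derivative_C, derivative_sub, derivative_X, derivative_one, eval_comp,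
    eval_add, eval_mul, eval_sub, eval_X, eval_C, eval_one, eval_pow, zero_mul, zero_add, sub_zero,
    mul_one]
  linear_combination (-2) * h

/-- The lowering relation is compatible with $x\mapsto -x$, $a\leftrightarrow b$ up to sign, so the
symmetry passes from $P_n^{(a+1,b+1)}$ to $P_{n+1}^{(a,b)}$. -/
theorem jacobiPoly_comp_neg (a b : ℝ) (n : ℕ) :
    (jacobiPoly a b n).comp (-X) = (-1) ^ n * jacobiPoly b a n := by
  induction n generalizing a b with
  | zero => simp [jacobiPoly_zero]
  | succ n ih =>
    have hn : (-2 * ((n : ℝ) + 1)) ≠ 0 := by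
      have : (0 : ℝ) < n + 1 := by positivity
      linarith
    refine mul_left_cancel₀ (C_ne_zero.2 hn) (Polynomial.funext fun x => ?_)
    have h1 := congrArg (eval (-x)) (jacobiPoly_succ_eq a b n)
    have h2 := congrArg (eval x) (jacobiPoly_succ_eq b a n)
    have h3 := congrArg (eval x) (ih (a + 1) (b + 1))
    have h4 := congrArg (eval x) (congrArg derivative (ih (a + 1) (b + 1)))
    have hd : derivative ((-1 : ℝ[X]) ^ n * jacobiPoly (b + 1) (a + 1) n)
        = (-1) ^ n * derivative (jacobiPoly (b + 1) (a + 1) n) := by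
      rw [show (-1 : ℝ[X]) = C (-1) by simp, ← C_pow, derivative_C_mul]
    rw [hd, derivative_comp] at h4
    simp only [derivative_neg, derivative_X, eval_add, eval_mul, eval_sub, eval_X, eval_C, eval_one,
      eval_pow, eval_neg, eval_comp] at h1 h2 h3 h4 ⊢
    rw [← h1, h3, pow_succ]
    linear_combination (-(1 - x ^ 2)) * h4 - (-1) ^ n * h2

theorem eval_neg_jacobiPoly (a b : ℝ) (n : ℕ) (x : ℝ) :
    (jacobiPoly a b n).eval (-x) = (-1) ^ n * (jacobiPoly b a n).eval x := by
  simpa [eval_comp] using congrArg (eval x) (jacobiPoly_comp_neg a b n)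

/-- The expansion of a Jacobi polynomial in powers of `1 + x`. -/
theorem eval_jacobiPoly_eq_sum_one_add (a b : ℝ) (n : ℕ) (x : ℝ) :
    (jacobiPoly a b n).eval x = ∑ k ∈ Finset.range (n + 1),
      (-1) ^ n * (n.choose k * (ascPochhammer ℝ k).eval (n + a + b + 1)
      * (ascPochhammer ℝ (n - k)).eval (b + k + 1) / n.factorial) * (-(1 / 2)) ^ k
        * (1 + x) ^ k := by
  have h := eval_neg_jacobiPoly a b n (-x)
  rw [neg_neg] at h
  rw [h, jacobiPoly, eval_finsetSum, Finset.mul_sum]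
  refine Finset.sum_congr rfl fun k _ => ?_
  simp only [eval_mul, eval_C, eval_pow, eval_sub, eval_X, eval_one]
  rw [show 1 / 2 * (-x - 1) = -(1 / 2) * (1 + x) by ring, mul_pow,
    show (n : ℝ) + b + a + 1 = n + a + b + 1 by ring]
  ring

/-! ### Positivity off the open interval, degree and leading coefficient -/

/-- All coefficients in powers of $(x-1)/2$ are nonnegative and the constant one is positive. The
condition on $n$ is what keeps $(n+a+b+1)_k$ positive; for $n=0$ only $k=0$ occurs. -/
theorem eval_jacobiPoly_pos {a b : ℝ} (ha : -1 < a) (n : ℕ) (h : n = 0 ∨ -1 < n + a + b) {x : ℝ}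
    (hx : 1 ≤ x) : 0 < (jacobiPoly a b n).eval x := by
  have hp : ∀ k, k ≤ n → 0 < (ascPochhammer ℝ k).eval (n + a + b + 1) := by
    intro k hk
    rcases h with h | h
    · obtain rfl : k = 0 := by omega
      simp
    · exact ascPochhammer_pos _ _ (by linarith)
  have hq : ∀ k j : ℕ, 0 < (ascPochhammer ℝ j).eval (a + k + 1) := fun k j =>
    ascPochhammer_pos _ _ (by have : (0 : ℝ) ≤ k := k.cast_nonneg
                              linarith)
  rw [jacobiPoly, eval_finsetSum]
  refine Finset.sum_pos' (fun k hk => ?_) ⟨0, by simp, ?_⟩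
  · have hk := Nat.lt_succ_iff.1 (Finset.mem_range.1 hk)
    simp only [eval_mul, eval_C, eval_pow, eval_sub, eval_X, eval_one]
    have := hp k hk
    have := hq k (n - k)
    have : 0 ≤ 1 / 2 * (x - 1) := by linarith
    positivity
  · have := hq 0 n
    simp only [pow_zero, mul_one, eval_C]
    simp only [Nat.choose_zero_right, Nat.cast_one, ascPochhammer_zero, eval_one, Nat.sub_zero]
    positivity

theorem eval_jacobiPoly_ne_zero_of_one_le_abs {a b : ℝ} (ha : -1 < a) (hb : -1 < b) (n : ℕ)
    (h : n = 0 ∨ -1 < n + a + b) {x : ℝ} (hx : 1 ≤ |x|) : (jacobiPoly a b n).eval x ≠ 0 := by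
  rcases le_abs.1 hx with hx | hx
  · exact (eval_jacobiPoly_pos ha n h hx).ne'
  · have := (eval_jacobiPoly_pos hb n (b := a) (by rwa [add_right_comm]) hx).ne'
    rw [← neg_neg x, eval_neg_jacobiPoly]
    exact mul_ne_zero (by simp) this

theorem natDegree_jacobiPoly_le (a b : ℝ) (n : ℕ) : (jacobiPoly a b n).natDegree ≤ n := by
  refine natDegree_sum_le_of_forall_le _ _ fun k hk => ?_
  have hk := Nat.lt_succ_iff.1 (Finset.mem_range.1 hk)
  refine (natDegree_C_mul_le _ _).trans (((natDegree_pow_le_of_le k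
    ((natDegree_C_mul_le _ _).trans ?_)).trans (mul_one k).le).trans hk)
  exact natDegree_X_sub_C_le (1 : ℝ)

theorem coeff_jacobiPoly_self (a b : ℝ) (n : ℕ) :
    (jacobiPoly a b n).coeff n
      = (ascPochhammer ℝ n).eval (n + a + b + 1) / n.factorial * (1 / 2) ^ n := by
  have hX : (X - 1 : ℝ[X]) = X - C 1 := by simp
  rw [jacobiPoly, finsetSum_coeff, Finset.sum_eq_single_of_mem n (by simp)]
  · rw [mul_pow, ← C_pow, coeff_C_mul, coeff_C_mul, hX]
    have : ((X - C (1 : ℝ)) ^ n).coeff n = 1 := by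
      have := ((monic_X_sub_C (1 : ℝ)).pow n).coeff_natDegree
      rwa [natDegree_pow, natDegree_X_sub_C, mul_one] at this
    rw [this]
    simp
  · intro k hk hkn
    have hk := Nat.lt_succ_iff.1 (Finset.mem_range.1 hk)
    rw [mul_pow, ← C_pow, coeff_C_mul, coeff_C_mul, hX, coeff_eq_zero_of_natDegree_lt]
    · simp
    · rw [natDegree_pow, natDegree_X_sub_C]
      omega

theorem coeff_jacobiPoly_self_pos {a b : ℝ} (n : ℕ) (h : n = 0 ∨ -1 < n + a + b) :
    0 < (jacobiPoly a b n).coeff n := by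
  rw [coeff_jacobiPoly_self]
  have : 0 < (ascPochhammer ℝ n).eval (n + a + b + 1) := by
    rcases h with rfl | h
    · simp
    · exact ascPochhammer_pos _ _ (by linarith)
  positivity

theorem natDegree_jacobiPoly {a b : ℝ} (n : ℕ) (h : n = 0 ∨ -1 < n + a + b) :
    (jacobiPoly a b n).natDegree = n :=
  natDegree_eq_of_le_of_coeff_ne_zero (natDegree_jacobiPoly_le a b n)
    (coeff_jacobiPoly_self_pos n h).ne'

theorem jacobi_index_condition {a b : ℝ} (ha : -1 < a) (hb : -1 < b) (n : ℕ) :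
    n = 0 ∨ -1 < n + a + b := by
  rcases n.eq_zero_or_pos with h | h
  · exact Or.inl h
  · have : (1 : ℝ) ≤ n := by exact_mod_cast h
    exact Or.inr (by linarith)

/-! ### Integration against the Jacobi weight, orthogonality and norms -/

theorem integral_rpow_mul_sub_rpow {u v c : ℝ} (hu : 0 < u) (hv : 0 < v) (hc : 0 < c) :
    ∫ y in (0 : ℝ)..c, y ^ (u - 1) * (c - y) ^ (v - 1)
      = c ^ (u + v - 1) * (Real.Gamma u * Real.Gamma v / Real.Gamma (u + v)) := by
  have h := Complex.betaIntegral_scaled u v hc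
  rw [Complex.betaIntegral_eq_Gamma_mul_div _ _ (by simpa) (by simpa), ← Complex.ofReal_add,
    Complex.Gamma_ofReal, Complex.Gamma_ofReal, Complex.Gamma_ofReal] at h
  apply Complex.ofReal_injective
  rw [← intervalIntegral.integral_ofReal]
  have h2 : ∫ y in (0 : ℝ)..c, ((y ^ (u - 1) * (c - y) ^ (v - 1) : ℝ) : ℂ)
      = ∫ x in (0 : ℝ)..c, (x : ℂ) ^ ((u : ℂ) - 1) * ((c : ℂ) - x) ^ ((v : ℂ) - 1) := by
    refine intervalIntegral.integral_congr fun y hy => ?_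
    rw [uIcc_of_le hc.le] at hy
    simp only [Complex.ofReal_mul, Complex.ofReal_cpow hy.1, Complex.ofReal_cpow (sub_nonneg.2 hy.2)]
    push_cast
    rfl
  rw [h2, h]
  push_cast [Complex.ofReal_cpow hc.le]
  rfl

theorem intervalIntegrable_jacobiWeight {a b : ℝ} (ha : -1 < a) (hb : -1 < b) :
    IntervalIntegrable (jacobiWeight a b) volume (-1) 1 := by
  have h1 : IntervalIntegrable (fun x : ℝ => (1 - x) ^ a) volume 0 1 := by
    simpa using ((intervalIntegrable_rpow' (a := 0) (b := 1) ha).comp_sub_left 1).symm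
  have h2 : IntervalIntegrable (fun x : ℝ => (1 + x) ^ b) volume (-1) 0 := by
    simpa using (intervalIntegrable_rpow' (a := 0) (b := 1) hb).comp_add_left 1
  refine IntervalIntegrable.trans (b := 0) ?_ ?_
  · refine h2.continuousOn_mul (ContinuousOn.rpow_const (by fun_prop) fun x hx => Or.inl ?_)
    rw [uIcc_of_le (by norm_num)] at hx
    linarith [hx.2]
  · refine h1.mul_continuousOn (ContinuousOn.rpow_const (by fun_prop) fun x hx => Or.inl ?_)
    rw [uIcc_of_le (by norm_num)] at hx
    linarith [hx.1]

theorem intervalIntegrable_eval_mul_jacobiWeight {a b : ℝ} (ha : -1 < a) (hb : -1 < b)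
    (p : ℝ[X]) : IntervalIntegrable (fun x => p.eval x * jacobiWeight a b x) volume (-1) 1 :=
  (intervalIntegrable_jacobiWeight ha hb).continuousOn_mul p.continuous.continuousOn

/-- Integration against the Jacobi weight, as a linear functional on polynomials. -/
noncomputable def jacobiIntegral {a b : ℝ} (ha : -1 < a) (hb : -1 < b) : ℝ[X] →ₗ[ℝ] ℝ where
  toFun p := ∫ x in (-1 : ℝ)..1, p.eval x * jacobiWeight a b x
  map_add' p q := by
    rw [← intervalIntegral.integral_add (intervalIntegrable_eval_mul_jacobiWeight ha hb p)
      (intervalIntegrable_eval_mul_jacobiWeight ha hb q)]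
    simp only [eval_add, add_mul]
  map_smul' c p := by
    rw [RingHom.id_apply, smul_eq_mul, ← intervalIntegral.integral_const_mul]
    simp only [eval_smul, smul_eq_mul, mul_assoc]

theorem jacobiIntegral_apply {a b : ℝ} (ha : -1 < a) (hb : -1 < b) (p : ℝ[X]) :
    jacobiIntegral ha hb p = ∫ x in (-1 : ℝ)..1, p.eval x * jacobiWeight a b x := rfl

theorem jacobiIntegral_C_mul {a b : ℝ} (ha : -1 < a) (hb : -1 < b) (c : ℝ) (p : ℝ[X]) :
    jacobiIntegral ha hb (C c * p) = c * jacobiIntegral ha hb p := by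
  rw [← smul_eq_C_mul, map_smul, smul_eq_mul]

theorem jacobiIntegral_one {a b : ℝ} (ha : -1 < a) (hb : -1 < b) :
    jacobiIntegral ha hb 1 = jacobiGamma a b 0 := by
  have h := integral_rpow_mul_sub_rpow (u := b + 1) (v := a + 1) (c := 2) (by linarith)
    (by linarith) two_pos
  have h2 := intervalIntegral.integral_comp_add_left (a := -1) (b := 1)
    (fun y : ℝ => y ^ (b + 1 - 1) * (2 - y) ^ (a + 1 - 1)) 1
  norm_num only [] at h2
  rw [h] at h2
  rw [jacobiIntegral_apply, jacobiGamma, if_pos rfl]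
  rw [show b + 1 + (a + 1) - 1 = a + b + 1 by ring, show b + 1 + (a + 1) = a + b + 2 by ring] at h2
  rw [show 2 ^ (a + b + 1) * Real.Gamma (a + 1) * Real.Gamma (b + 1) / Real.Gamma (a + b + 2)
    = 2 ^ (a + b + 1) * (Real.Gamma (b + 1) * Real.Gamma (a + 1) / Real.Gamma (a + b + 2)) by ring,
    ← h2]
  refine intervalIntegral.integral_congr fun y _ => ?_
  simp only [jacobiWeight, eval_one, one_mul, add_sub_cancel_right]
  rw [show 2 - (1 + y) = 1 - y by ring, mul_comm]

theorem jacobiWeight_add_one {a b x : ℝ} (hx : x ∈ Ioo (-1 : ℝ) 1) :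
    jacobiWeight (a + 1) (b + 1) x = (1 - x ^ 2) * jacobiWeight a b x := by
  have h1 : 1 - x ≠ 0 := by linarith [hx.2]
  have h2 : 1 + x ≠ 0 := by linarith [hx.1]
  rw [jacobiWeight, jacobiWeight, Real.rpow_add_one h1, Real.rpow_add_one h2]
  ring

theorem jacobiIntegral_one_sub_sq_mul {a b : ℝ} (ha : -1 < a) (hb : -1 < b) (ha' : -1 < a + 1)
    (hb' : -1 < b + 1) (p : ℝ[X]) :
    jacobiIntegral ha hb ((1 - X ^ 2) * p) = jacobiIntegral ha' hb' p := by
  rw [jacobiIntegral_apply, jacobiIntegral_apply]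
  refine intervalIntegral.integral_congr_Ioo_of_le (by norm_num) fun x hx => ?_
  simp only [jacobiWeight_add_one hx, eval_mul, eval_sub, eval_pow, eval_one, eval_X]
  ring

/-- The integrand is the derivative of $(1-x)^{a+1}(1+x)^{b+1}p(x)$, which vanishes at both
endpoints because $a+1,b+1>0$. -/
theorem jacobiIntegral_divergence {a b : ℝ} (ha : -1 < a) (hb : -1 < b) (p : ℝ[X]) :
    jacobiIntegral ha hb
      ((1 - X ^ 2) * derivative p + (C (b - a) - C (a + b + 2) * X) * p) = 0 := by
  have hc : ContinuousOn (fun x => jacobiWeight (a + 1) (b + 1) x * p.eval x) (Icc (-1) 1) := by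
    refine ContinuousOn.mul (ContinuousOn.mul ?_ ?_) p.continuous.continuousOn
    · exact ContinuousOn.rpow_const (by fun_prop) fun x _ => Or.inr (by linarith)
    · exact ContinuousOn.rpow_const (by fun_prop) fun x _ => Or.inr (by linarith)
  have h := integral_eq_sub_of_hasDerivAt_of_le (by norm_num) hc (f' := fun x =>
    ((1 - X ^ 2) * derivative p + (C (b - a) - C (a + b + 2) * X) * p).eval x
      * jacobiWeight a b x) ?_ (intervalIntegrable_eval_mul_jacobiWeight ha hb _)
  · rw [jacobiIntegral_apply, h]
    have h1 : a + 1 ≠ 0 := by linarith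
    have h2 : b + 1 ≠ 0 := by linarith
    simp [jacobiWeight, Real.zero_rpow h1, Real.zero_rpow h2]
  · intro x hx
    have h1 : 1 - x ≠ 0 := by linarith [hx.2]
    have h2 : 1 + x ≠ 0 := by linarith [hx.1]
    have d1 : HasDerivAt (fun y : ℝ => (1 - y) ^ (a + 1)) (-1 * (a + 1) * (1 - x) ^ (a + 1 - 1)) x :=
      ((hasDerivAt_id x).const_sub 1).rpow_const (Or.inl h1)
    have d2 : HasDerivAt (fun y : ℝ => (1 + y) ^ (b + 1)) (1 * (b + 1) * (1 + x) ^ (b + 1 - 1)) x :=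
      ((hasDerivAt_id x).const_add 1).rpow_const (Or.inl h2)
    refine ((d1.mul d2).mul (p.hasDerivAt x)).congr_deriv ?_
    simp only [Pi.mul_apply, add_sub_cancel_right, Real.rpow_add_one h1, Real.rpow_add_one h2,
      jacobiWeight, eval_add, eval_mul, eval_sub, eval_pow, eval_one, eval_X, eval_C]
    ring

/-- Apply the divergence identity to $P_n^{(a+1,b+1)}q$: the lowering relation collects the terms
without $q'$ into $P_{n+1}^{(a,b)}q$, and the factor $1-x^2$ of the other term is absorbed into the
weight. -/
theorem jacobiIntegral_succ_mul {a b : ℝ} (ha : -1 < a) (hb : -1 < b) (ha' : -1 < a + 1)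
    (hb' : -1 < b + 1) (n : ℕ) (q : ℝ[X]) :
    jacobiIntegral ha hb (jacobiPoly a b (n + 1) * q)
      = 1 / (2 * (n + 1)) *
        jacobiIntegral ha' hb' (jacobiPoly (a + 1) (b + 1) n * derivative q) := by
  have h := jacobiIntegral_divergence ha hb (jacobiPoly (a + 1) (b + 1) n * q)
  have e : (1 - X ^ 2) * derivative (jacobiPoly (a + 1) (b + 1) n * q)
      + (C (b - a) - C (a + b + 2) * X) * (jacobiPoly (a + 1) (b + 1) n * q)
      = C (-2 * (n + 1 : ℝ)) * (jacobiPoly a b (n + 1) * q)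
        + (1 - X ^ 2) * (jacobiPoly (a + 1) (b + 1) n * derivative q) := by
    rw [derivative_mul, ← mul_assoc (C _), ← jacobiPoly_succ_eq]
    ring
  rw [e, map_add, jacobiIntegral_C_mul, jacobiIntegral_one_sub_sq_mul ha hb ha' hb'] at h
  have hn : (n : ℝ) + 1 ≠ 0 := by positivity
  field_simp
  linarith

/-- Each step lowers $n$ and differentiates $q$, until $q$ is constant and its derivative vanishes.
The parameters grow along the way, so the induction is uniform in them. -/
theorem jacobiIntegral_mul_eq_zero {a b : ℝ} (ha : -1 < a) (hb : -1 < b) {n : ℕ} {q : ℝ[X]}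
    (hq : q.natDegree < n) : jacobiIntegral ha hb (jacobiPoly a b n * q) = 0 := by
  induction n generalizing a b q with
  | zero => omega
  | succ n ih =>
    rw [jacobiIntegral_succ_mul ha hb (by linarith) (by linarith)]
    rcases Nat.eq_zero_or_pos q.natDegree with h0 | h0
    · rw [eq_C_of_natDegree_eq_zero h0]
      simp
    · rw [ih _ _ (lt_of_lt_of_le (natDegree_derivative_lt h0.ne') (Nat.lt_succ_iff.1 hq)), mul_zero]

theorem jacobiGamma_pos {a b : ℝ} (ha : -1 < a) (hb : -1 < b) (n : ℕ) : 0 < jacobiGamma a b n := by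
  rw [jacobiGamma]
  split_ifs with h
  · have := Real.Gamma_pos_of_pos (show 0 < a + 1 by linarith)
    have := Real.Gamma_pos_of_pos (show 0 < b + 1 by linarith)
    have := Real.Gamma_pos_of_pos (show 0 < a + b + 2 by linarith)
    positivity
  · have hn : (1 : ℝ) ≤ n := by exact_mod_cast Nat.pos_of_ne_zero h
    have := Real.Gamma_pos_of_pos (show 0 < n + a + 1 by linarith)
    have := Real.Gamma_pos_of_pos (show 0 < n + b + 1 by linarith)
    have := Real.Gamma_pos_of_pos (show 0 < n + a + b + 1 by linarith)
    have : 0 < 2 * n + a + b + 1 := by linarith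
    positivity

theorem jacobiGamma_succ {a b : ℝ} (ha : -1 < a) (hb : -1 < b) (n : ℕ) :
    jacobiGamma a b (n + 1)
      = (n + a + b + 2) / (4 * (n + 1)) * jacobiGamma (a + 1) (b + 1) n := by
  have h2 : (2 : ℝ) ^ (a + 1 + (b + 1) + 1) = 4 * 2 ^ (a + b + 1) := by
    rw [show a + 1 + (b + 1) + 1 = a + b + 1 + 2 by ring, Real.rpow_add two_pos]
    norm_num [mul_comm]
  rw [jacobiGamma, jacobiGamma, if_neg n.succ_ne_zero, h2]
  rcases n with _ | n
  · rw [if_pos rfl]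
    have g1 := Real.Gamma_add_one (show a + b + 3 ≠ 0 by linarith)
    have g2 := Real.Gamma_add_one (show a + b + 2 ≠ 0 by linarith)
    have p1 := (Real.Gamma_pos_of_pos (show 0 < a + b + 2 by linarith)).ne'
    rw [show a + b + 3 + 1 = a + 1 + (b + 1) + 2 by ring] at g1
    rw [show a + b + 2 + 1 = a + b + 3 by ring] at g2
    rw [g1, g2]
    have n1 : a + b + 3 ≠ 0 := by linarith
    have n2 : a + b + 2 ≠ 0 := by linarith
    norm_num
    rw [show 1 + a + 1 = a + 1 + 1 by ring, show 1 + b + 1 = b + 1 + 1 by ring,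
      show 2 + a + b + 1 = a + b + 3 by ring, show 1 + a + b + 1 = a + b + 2 by ring]
    field_simp
  · rw [if_neg n.succ_ne_zero]
    have hn : (0 : ℝ) ≤ n := n.cast_nonneg
    have g := Real.Gamma_add_one (show n + a + b + 3 ≠ 0 by linarith)
    have p1 := (Real.Gamma_pos_of_pos (show 0 < n + a + b + 3 by linarith)).ne'
    have n1 : (n : ℝ) + a + b + 3 ≠ 0 := by linarith
    have n2 : 2 * (n : ℝ) + a + b + 5 ≠ 0 := by linarith
    rw [Nat.factorial_succ (n + 1)]
    push_cast
    rw [show (n : ℝ) + 1 + (a + 1) + 1 = n + 1 + 1 + a + 1 by ring,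
      show (n : ℝ) + 1 + (b + 1) + 1 = n + 1 + 1 + b + 1 by ring,
      show (n : ℝ) + 1 + (a + 1) + (b + 1) + 1 = n + a + b + 3 + 1 by ring, g,
      show (n : ℝ) + 1 + 1 + a + b + 1 = n + a + b + 3 by ring,
      show 2 * ((n : ℝ) + 1) + (a + 1) + (b + 1) + 1 = 2 * n + a + b + 5 by ring,
      show 2 * ((n : ℝ) + 1 + 1) + a + b + 1 = 2 * n + a + b + 5 by ring,
      show (n : ℝ) + 1 + a + b + 2 = n + a + b + 3 by ring]
    field_simp

/-- Taking $q=P_{n+1}^{(a,b)}$ in the reduction formula gives the recursion of `jacobiGamma_succ`.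
-/
theorem jacobiIntegral_mul_self {a b : ℝ} (ha : -1 < a) (hb : -1 < b) (n : ℕ) :
    jacobiIntegral ha hb (jacobiPoly a b n * jacobiPoly a b n) = jacobiGamma a b n := by
  induction n generalizing a b with
  | zero => rw [jacobiPoly_zero, one_mul, jacobiIntegral_one]
  | succ n ih =>
    rw [jacobiIntegral_succ_mul ha hb (by linarith) (by linarith), derivative_jacobiPoly_succ,
      mul_left_comm, jacobiIntegral_C_mul, ih, jacobiGamma_succ ha hb]
    field_simp
    ring

/-! ### Expansion in Jacobi polynomials -/

theorem exists_eq_sum_jacobiPoly {a b : ℝ} (ha : -1 < a) (hb : -1 < b) {n : ℕ} {p : ℝ[X]}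
    (hp : p.natDegree < n) :
    ∃ c : ℕ → ℝ, p = ∑ k ∈ Finset.range n, C (c k) * jacobiPoly a b k := by
  induction n generalizing p with
  | zero => omega
  | succ n ih =>
    have hc := coeff_jacobiPoly_self_pos n (jacobi_index_condition ha hb n)
    set q := p - C (p.coeff n / (jacobiPoly a b n).coeff n) * jacobiPoly a b n with hq
    have hqn : q.coeff n = 0 := by
      rw [hq, coeff_sub, coeff_C_mul, div_mul_cancel₀ _ hc.ne', sub_self]
    have hqd : q.natDegree ≤ n := by
      exact (natDegree_sub_le_of_le (Nat.lt_succ_iff.1 hp) ((natDegree_C_mul_le _ _).trans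
        (natDegree_jacobiPoly_le a b n))).trans (max_self n).le
    -- Cancelling the leading term does not lower `natDegree` when it is already $0$, so constants
    -- are treated apart.
    rcases n with _ | n
    · refine ⟨fun _ => p.coeff 0, ?_⟩
      simpa [jacobiPoly_zero] using eq_C_of_natDegree_le_zero (Nat.lt_succ_iff.1 hp)
    · have hlt : q.natDegree < n + 1 := by
        refine lt_of_le_of_ne hqd fun h => ?_
        rw [← h, coeff_natDegree, leadingCoeff_eq_zero] at hqn
        rw [hqn, natDegree_zero] at h
        omega
      obtain ⟨c, hcq⟩ := ih hlt
      refine ⟨fun k => if k = n + 1 then p.coeff (n + 1) / (jacobiPoly a b (n + 1)).coeff (n + 1)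
        else c k, ?_⟩
      rw [Finset.sum_range_succ]
      beta_reduce
      rw [if_pos rfl, ← sub_eq_iff_eq_add, ← hq, hcq]
      refine Finset.sum_congr rfl fun k hk => ?_
      rw [if_neg (Finset.mem_range.1 hk).ne]

theorem jacobiIntegral_mul_of_ne {a b : ℝ} (ha : -1 < a) (hb : -1 < b) {m n : ℕ} (h : m ≠ n) :
    jacobiIntegral ha hb (jacobiPoly a b m * jacobiPoly a b n) = 0 := by
  rcases lt_or_gt_of_ne h with h | h
  · rw [mul_comm]
    exact jacobiIntegral_mul_eq_zero ha hb ((natDegree_jacobiPoly_le a b m).trans_lt h)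
  · exact jacobiIntegral_mul_eq_zero ha hb ((natDegree_jacobiPoly_le a b n).trans_lt h)

theorem jacobiIntegral_mul_sum {a b : ℝ} (ha : -1 < a) (hb : -1 < b) {n k : ℕ} (hk : k < n)
    (c : ℕ → ℝ) : jacobiIntegral ha hb
      (jacobiPoly a b k * ∑ i ∈ Finset.range n, C (c i) * jacobiPoly a b i)
      = c k * jacobiGamma a b k := by
  rw [Finset.mul_sum, map_sum, Finset.sum_eq_single_of_mem k (Finset.mem_range.2 hk)]
  · rw [mul_left_comm, jacobiIntegral_C_mul, jacobiIntegral_mul_self]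
  · intro i _ hi
    rw [mul_left_comm, jacobiIntegral_C_mul, jacobiIntegral_mul_of_ne ha hb hi.symm, mul_zero]

theorem eq_sum_jacobiPoly {a b : ℝ} (ha : -1 < a) (hb : -1 < b) {n : ℕ} {p : ℝ[X]}
    (hp : p.natDegree < n) :
    p = ∑ k ∈ Finset.range n,
      C (1 / jacobiGamma a b k * jacobiIntegral ha hb (jacobiPoly a b k * p))
        * jacobiPoly a b k := by
  obtain ⟨c, hc⟩ := exists_eq_sum_jacobiPoly ha hb hp
  nth_rw 1 [hc]
  refine Finset.sum_congr rfl fun k hk => ?_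
  rw [hc, jacobiIntegral_mul_sum ha hb (Finset.mem_range.1 hk)]
  have := (jacobiGamma_pos ha hb k).ne'
  field_simp

theorem natDegree_lt_of_le_of_coeff_eq_zero {p : ℝ[X]} {n : ℕ} (hn : 0 < n) (h : p.natDegree ≤ n)
    (hc : p.coeff n = 0) : p.natDegree < n := by
  refine lt_of_le_of_ne h fun he => ?_
  rw [← he, coeff_natDegree, leadingCoeff_eq_zero] at hc
  rw [hc, natDegree_zero] at he
  omega

/-! ### Gauss-Lobatto nodes, quadrature and discrete orthogonality (with $N=m+1$) -/

section Nodes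

variable {m : ℕ} {α β : ℝ} {x : Fin (m + 1 + 1) → ℝ}

theorem natDegree_one_sub_X_sq : (1 - X ^ 2 : ℝ[X]).natDegree = 2 := by
  rw [← neg_sub, natDegree_neg]
  simpa using natDegree_X_pow_sub_C (n := 2) (r := (1 : ℝ))

theorem mem_range_iff_of_isJGLPoints (hα : -1 < α) (hβ : -1 < β) (hx : IsJGLPoints α β x) (y : ℝ) :
    y ∈ range x ↔ (1 - y ^ 2) * (jacobiPoly (α + 1) (β + 1) m).eval y = 0 := by
  have hc : ((m : ℝ) + α + β + 2) / 2 ≠ 0 := by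
    have : (0 : ℝ) ≤ m := m.cast_nonneg
    linarith
  rw [hx.2, mem_ofPred_eq, derivative_jacobiPoly_succ, eval_mul, eval_C, mul_left_comm,
    mul_eq_zero_iff_left hc]

theorem abs_le_one_of_isJGLPoints (hα : -1 < α) (hβ : -1 < β) (hx : IsJGLPoints α β x)
    (j : Fin (m + 1 + 1)) : |x j| ≤ 1 := by
  by_contra! h
  rcases mul_eq_zero.1 ((mem_range_iff_of_isJGLPoints hα hβ hx (x j)).1 ⟨j, rfl⟩) with h0 | h0
  · have : |x j| ^ 2 = 1 := by
      rw [sq_abs]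
      linarith
    nlinarith
  · refine eval_jacobiPoly_ne_zero_of_one_le_abs (by linarith) (by linarith) m (Or.inr ?_) h.le h0
    have : (0 : ℝ) ≤ m := m.cast_nonneg
    linarith

/-- The point $-1$ is a node because of the factor $1-y^2$, and no node lies below it, so it is the
first. -/
theorem isJGLPoints_zero (hα : -1 < α) (hβ : -1 < β) (hx : IsJGLPoints α β x) : x 0 = -1 := by
  obtain ⟨j, hj⟩ := (mem_range_iff_of_isJGLPoints hα hβ hx (-1)).2 (by norm_num)
  refine le_antisymm ?_ (abs_le.1 (abs_le_one_of_isJGLPoints hα hβ hx 0)).1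
  rw [← hj]
  exact hx.1.monotone (Fin.zero_le j)

theorem isJGLPoints_last (hα : -1 < α) (hβ : -1 < β) (hx : IsJGLPoints α β x) :
    x (Fin.last (m + 1)) = 1 := by
  obtain ⟨j, hj⟩ := (mem_range_iff_of_isJGLPoints hα hβ hx 1).2 (by norm_num)
  refine le_antisymm (abs_le.1 (abs_le_one_of_isJGLPoints hα hβ hx _)).2 ?_
  rw [← hj]
  exact hx.1.monotone (Fin.le_last j)

theorem eval_lagrangeBasis {N : ℕ} {x : Fin (N + 1) → ℝ} (hx : Function.Injective x)
    (i j : Fin (N + 1)) : (lagrangeBasis x j).eval (x i) = if i = j then 1 else 0 := by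
  split_ifs with h
  · subst h
    exact Lagrange.eval_basis_self hx.injOn (Finset.mem_univ _)
  · exact Lagrange.eval_basis_of_ne (Ne.symm h) (Finset.mem_univ _)

theorem natDegree_lagrangeBasis {N : ℕ} {x : Fin (N + 1) → ℝ} (hx : Function.Injective x)
    (j : Fin (N + 1)) : (lagrangeBasis x j).natDegree = N := by
  rw [lagrangeBasis, Lagrange.natDegree_basis hx.injOn (Finset.mem_univ _)]
  simp

theorem sum_quadratureWeight_of_natDegree_le {N : ℕ} {x : Fin (N + 1) → ℝ} (hα : -1 < α)
    (hβ : -1 < β) (hx : Function.Injective x) {p : ℝ[X]} (hp : p.natDegree ≤ N) :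
    ∑ j, quadratureWeight α β x j * p.eval (x j) = jacobiIntegral hα hβ p := by
  have h : p = ∑ j, C (p.eval (x j)) * lagrangeBasis x j := by
    nth_rw 1 [Lagrange.eq_interpolate (s := Finset.univ) (v := x) hx.injOn (f := p)
      (degree_le_natDegree.trans_lt (by simpa using Nat.cast_lt.2 (Nat.lt_succ_iff.2 hp)))]
    rfl
  nth_rw 2 [h]
  rw [map_sum]
  refine Finset.sum_congr rfl fun j _ => ?_
  rw [jacobiIntegral_C_mul, mul_comm]
  rfl

/-- Jacobi-Gauss-Lobatto quadrature with `m + 2` nodes is exact up to degree `2 m + 1`. -/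
theorem sum_quadratureWeight_of_isJGLPoints (hα : -1 < α) (hβ : -1 < β) (hx : IsJGLPoints α β x)
    {p : ℝ[X]} (hp : p.natDegree ≤ 2 * m + 1) :
    ∑ j, quadratureWeight α β x j * p.eval (x j) = jacobiIntegral hα hβ p := by
  -- `W` has degree $m+2$ and vanishes at every node, so modulo `W` nodal values are unchanged.
  set W : ℝ[X] := (1 - X ^ 2) * jacobiPoly (α + 1) (β + 1) m with hW
  have hm : (0 : ℝ) ≤ m := m.cast_nonneg
  have hi : m = 0 ∨ -1 < (m : ℝ) + (α + 1) + (β + 1) := Or.inr (by linarith)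
  have hQ0 : jacobiPoly (α + 1) (β + 1) m ≠ 0 := fun h => by
    simpa [h] using coeff_jacobiPoly_self_pos m hi
  have hS0 : (1 - X ^ 2 : ℝ[X]) ≠ 0 := fun h => by
    simpa [h] using natDegree_one_sub_X_sq
  have hW0 : W ≠ 0 := mul_ne_zero hS0 hQ0
  have hWd : W.natDegree = m + 2 := by
    rw [hW, natDegree_mul hS0 hQ0, natDegree_jacobiPoly m hi, natDegree_one_sub_X_sq, add_comm]
  have hr : (p % W).natDegree ≤ m + 1 := by
    have := natDegree_mod_lt p (q := W) (by omega)
    omega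
  have hpq := EuclideanDomain.div_add_mod p W
  -- The factor $1-x^2$ raises the weight to $(\alpha+1,\beta+1)$, for which
  -- $P_m^{(\alpha+1,\beta+1)}$ is orthogonal to the quotient of degree less than $m$.
  have hz : jacobiIntegral hα hβ (W * (p / W)) = 0 := by
    rw [hW, mul_assoc, ← hW, jacobiIntegral_one_sub_sq_mul hα hβ (by linarith) (by linarith)]
    by_cases h0 : p / W = 0
    · rw [h0, mul_zero, map_zero]
    · refine jacobiIntegral_mul_eq_zero _ _ ?_
      have h1 := natDegree_mul hW0 h0
      have h2 := natDegree_sub_le_of_le hp hr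
      rw [sub_eq_iff_eq_add.2 hpq.symm] at h2
      omega
  have hnode : ∀ j, p.eval (x j) = (p % W).eval (x j) := fun j => by
    nth_rw 1 [← hpq]
    have := (mem_range_iff_of_isJGLPoints hα hβ hx (x j)).1 ⟨j, rfl⟩
    rw [eval_add, eval_mul, hW]
    simp [this]
  simp only [hnode]
  rw [sum_quadratureWeight_of_natDegree_le hα hβ hx.1.injective hr]
  nth_rw 2 [← hpq]
  rw [map_add, hz, zero_add]

/-- The degree $2m+2$ is one too high for exactness. Adding a multiple of $(1-x^2)P'^2$, which
vanishes at the nodes, cancels the leading term; its integral supplies the extra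
$1+(\alpha+\beta+1)/N$ in $\tilde\gamma_N$. -/
theorem sum_quadratureWeight_sq (hα : -1 < α) (hβ : -1 < β) (hx : IsJGLPoints α β x) :
    ∑ j, quadratureWeight α β x j *
      (jacobiPoly α β (m + 1) * jacobiPoly α β (m + 1)).eval (x j)
      = jacobiGammaTilde α β (m + 1) (m + 1) := by
  set P := jacobiPoly α β (m + 1) with hP
  set D := (1 - X ^ 2) * (derivative P * derivative P) with hD
  -- If $P$ has leading coefficient $\kappa$, then $(1-x^2)P'^2$ has leading coefficient
  -- $-(m+1)^2\kappa^2$.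
  set T := P * P + C (1 / ((m : ℝ) + 1) ^ 2) * D with hT
  have hm : (m : ℝ) + 1 ≠ 0 := by positivity
  have hPd : P.natDegree ≤ m + 1 := natDegree_jacobiPoly_le _ _ _
  have hPd' : (derivative P).natDegree ≤ m := (natDegree_derivative_le P).trans (by omega)
  have hDd : D.natDegree ≤ 2 * m + 2 :=
    natDegree_mul_le.trans (by
      have := natDegree_mul_le_of_le hPd' hPd'
      rw [natDegree_one_sub_X_sq]
      omega)
  have hPc : (P * P).coeff (2 * m + 2) = P.coeff (m + 1) * P.coeff (m + 1) := by
    rw [show 2 * m + 2 = m + 1 + (m + 1) by ring]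
    exact coeff_mul_add_eq_of_natDegree_le hPd hPd
  have hDc : D.coeff (2 * m + 2) = -((m + 1) ^ 2 * (P.coeff (m + 1) * P.coeff (m + 1))) := by
    rw [show 2 * m + 2 = 2 + (m + m) by ring, hD,
      coeff_mul_add_eq_of_natDegree_le natDegree_one_sub_X_sq.le (natDegree_mul_le_of_le hPd' hPd'),
      coeff_mul_add_eq_of_natDegree_le hPd' hPd', coeff_derivative, coeff_sub, coeff_one, coeff_X_pow]
    norm_num
    ring
  have hTd : T.natDegree ≤ 2 * m + 1 := by
    refine Nat.lt_succ_iff.1 (natDegree_lt_of_le_of_coeff_eq_zero (by omega) ?_ ?_)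
    · refine natDegree_add_le_of_degree_le ?_ ((natDegree_C_mul_le _ _).trans hDd)
      exact natDegree_mul_le.trans (by omega)
    · rw [hT, coeff_add, coeff_C_mul]
      change (P * P).coeff (2 * m + 2) + _ * D.coeff (2 * m + 2) = 0
      rw [hPc, hDc]
      field_simp
      ring
  have hnode : ∀ j, (P * P).eval (x j) = T.eval (x j) := fun j => by
    have h : (1 - x j ^ 2) * (derivative P).eval (x j) = 0 := by
      have : x j ∈ range x := ⟨j, rfl⟩
      rwa [hx.2] at this
    simp only [hT, hD, eval_add, eval_mul, eval_C, eval_sub, eval_one, eval_pow, eval_X]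
    rw [← mul_assoc (1 - x j ^ 2), h]
    ring
  simp only [hnode]
  rw [sum_quadratureWeight_of_isJGLPoints hα hβ hx hTd, hT, map_add, hP, jacobiIntegral_mul_self,
    jacobiIntegral_C_mul, hD, jacobiIntegral_one_sub_sq_mul hα hβ (by linarith) (by linarith), hP,
    derivative_jacobiPoly_succ, mul_mul_mul_comm, ← C_mul, jacobiIntegral_C_mul,
    jacobiIntegral_mul_self, jacobiGammaTilde, if_pos rfl, jacobiGamma_succ hα hβ]
  push_cast
  field_simp
  ring

theorem jacobiGammaTilde_pos {N : ℕ} (hα : -1 < α) (hβ : -1 < β) (hN : 0 < N) (n : ℕ) :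
    0 < jacobiGammaTilde α β N n := by
  rw [jacobiGammaTilde]
  split_ifs
  · refine mul_pos ?_ (jacobiGamma_pos hα hβ N)
    have h1 : (1 : ℝ) ≤ N := by exact_mod_cast hN
    have : 2 + (α + β + 1) / N = (2 * N + α + β + 1) / N := by
      field_simp
      ring
    rw [this]
    exact div_pos (by linarith) (by linarith)
  · exact jacobiGamma_pos hα hβ n

/-- Discrete orthogonality of the Jacobi polynomials on the Gauss-Lobatto points. -/
theorem sum_quadratureWeight_jacobiPoly_mul (hα : -1 < α) (hβ : -1 < β) (hx : IsJGLPoints α β x)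
    {n k : ℕ} (hn : n ≤ m + 1) (hk : k ≤ m + 1) :
    ∑ j, quadratureWeight α β x j * (jacobiPoly α β n * jacobiPoly α β k).eval (x j)
      = if n = k then jacobiGammaTilde α β (m + 1) n else 0 := by
  by_cases h : n = m + 1 ∧ k = m + 1
  · rw [h.1, h.2, if_pos rfl, sum_quadratureWeight_sq hα hβ hx]
  · have hd := natDegree_mul_le_of_le (natDegree_jacobiPoly_le α β n) (natDegree_jacobiPoly_le α β k)
    rw [sum_quadratureWeight_of_isJGLPoints hα hβ hx (hd.trans (by omega))]
    split_ifs with hnk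
    · subst hnk
      rw [jacobiIntegral_mul_self, jacobiGammaTilde, if_neg (by omega)]
    · exact jacobiIntegral_mul_of_ne hα hβ hnk

/-- The discrete pairing of $P_n$ with $h_j$ is computed twice: by the delta property of $h_j$, and
by discrete orthogonality. -/
theorem lagrangeBasis_eq_sum (hα : -1 < α) (hβ : -1 < β) (hx : IsJGLPoints α β x)
    (j : Fin (m + 1 + 1)) :
    lagrangeBasis x j = ∑ n ∈ Finset.range (m + 1 + 1), C (tCoeff α β x n j) * jacobiPoly α β n := by
  obtain ⟨c, hc⟩ := exists_eq_sum_jacobiPoly hα hβ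
    (Nat.lt_succ_iff.2 (natDegree_lagrangeBasis hx.1.injective j).le)
  rw [hc]
  refine Finset.sum_congr rfl fun n hn => ?_
  have hn' : n ≤ m + 1 := Nat.lt_succ_iff.1 (Finset.mem_range.1 hn)
  have h1 : ∑ i, quadratureWeight α β x i * (jacobiPoly α β n * lagrangeBasis x j).eval (x i)
      = quadratureWeight α β x j * (jacobiPoly α β n).eval (x j) := by
    simp [eval_lagrangeBasis hx.1.injective]
  have h2 : ∑ i, quadratureWeight α β x i * (jacobiPoly α β n * lagrangeBasis x j).eval (x i)
      = c n * jacobiGammaTilde α β (m + 1) n := by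
    have e : ∀ i, quadratureWeight α β x i * (jacobiPoly α β n * lagrangeBasis x j).eval (x i)
        = ∑ k ∈ Finset.range (m + 1 + 1), c k *
          (quadratureWeight α β x i * (jacobiPoly α β n * jacobiPoly α β k).eval (x i)) := fun i => by
      rw [hc, eval_mul, eval_finsetSum, Finset.mul_sum, Finset.mul_sum]
      refine Finset.sum_congr rfl fun k _ => ?_
      simp only [eval_mul, eval_C]
      ring
    simp only [e]
    rw [Finset.sum_comm, Finset.sum_eq_single_of_mem n hn]
    · rw [← Finset.mul_sum, sum_quadratureWeight_jacobiPoly_mul hα hβ hx hn' hn', if_pos rfl]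
    · intro k hk hkn
      rw [← Finset.mul_sum, sum_quadratureWeight_jacobiPoly_mul hα hβ hx hn'
        (Nat.lt_succ_iff.1 (Finset.mem_range.1 hk)), if_neg hkn.symm, mul_zero]
  congr 2
  have hg := (jacobiGammaTilde_pos hα hβ m.succ_pos n).ne'
  rw [tCoeff, div_mul_eq_mul_div, ← h1, h2]
  field_simp

/-! ### Legendre coefficients of the derivatives of the Lagrange basis -/

theorem derivative_lagrangeBasis_eq_sum (hα : -1 < α) (hβ : -1 < β) (hx : IsJGLPoints α β x)
    (j : Fin (m + 1 + 1)) :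
    derivative (lagrangeBasis x j) = ∑ n ∈ Finset.Icc 1 (m + 1),
      C ((n + α + β + 1) / 2 * tCoeff α β x n j) * jacobiPoly (α + 1) (β + 1) (n - 1) := by
  have hI : Finset.Icc 1 (m + 1) = Finset.Ico 1 (m + 1 + 1) := rfl
  rw [lagrangeBasis_eq_sum hα hβ hx, derivative_sum, Finset.sum_range_succ', hI,
    Finset.sum_Ico_eq_sum_range]
  rw [jacobiPoly_zero, mul_one, derivative_C, add_zero]
  refine Finset.sum_congr rfl fun n _ => ?_
  rw [derivative_C_mul, derivative_jacobiPoly_succ, add_comm 1 n, Nat.add_sub_cancel, ← mul_assoc,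
    ← C_mul]
  congr 2
  push_cast
  ring

/-- The coefficients `s_{lj}` are the Legendre coefficients of `h_j'`. -/
theorem sCoeff_eq (hα : -1 < α) (hβ : -1 < β) (hx : IsJGLPoints α β x) (l : ℕ)
    (j : Fin (m + 1 + 1)) (h0 : (-1 : ℝ) < 0) :
    sCoeff α β x (l + 1) j = 1 / jacobiGamma 0 0 l *
      jacobiIntegral h0 h0 (jacobiPoly 0 0 l * derivative (lagrangeBasis x j)) := by
  have hconn : ∀ n, jacobiConnection (α + 1) (β + 1) 0 0 l n = 1 / jacobiGamma 0 0 l *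
      jacobiIntegral h0 h0 (jacobiPoly 0 0 l * jacobiPoly (α + 1) (β + 1) n) := fun n => by
    simp only [jacobiConnection, jacobiIntegral_apply, eval_mul]
  rw [derivative_lagrangeBasis_eq_sum hα hβ hx, Finset.mul_sum, map_sum, sCoeff, Finset.mul_sum,
    Finset.mul_sum]
  refine (Finset.sum_congr rfl fun n _ => ?_).trans
    -- The sum may start at $n=1$: the added terms have $n-1<l$, so their connection coefficients
    -- vanish.
    (Finset.sum_subset (Finset.Icc_subset_Icc (le_max_left _ _) le_rfl) fun n hn hn' => ?_)
  · rw [mul_left_comm (jacobiPoly 0 0 l), jacobiIntegral_C_mul, Nat.add_sub_cancel, hconn]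
    ring
  · rw [mul_left_comm (jacobiPoly 0 0 l), jacobiIntegral_C_mul, jacobiIntegral_mul_eq_zero, mul_zero, mul_zero]
    refine (natDegree_jacobiPoly_le _ _ _).trans_lt ?_
    simp only [Finset.mem_Icc] at hn hn'
    omega

end Nodes

/-! ### Fractional integrals of Legendre polynomials -/

theorem intervalIntegrable_eval_div_sub_rpow {μ x : ℝ} (hμ : μ < 1) (hx : -1 ≤ x) (p : ℝ[X]) :
    IntervalIntegrable (fun y => p.eval y / (x - y) ^ μ) volume (-1) x := by
  have h : IntervalIntegrable (fun y : ℝ => (x - y) ^ (-μ)) volume (-1) x := by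
    simpa using ((intervalIntegrable_rpow' (a := 0) (b := x + 1)
      (show -1 < -μ by linarith)).comp_sub_left x).symm
  refine (h.continuousOn_mul p.continuous.continuousOn).congr_uIoo fun y hy => ?_
  rw [uIoo_of_le hx] at hy
  simp only [Real.rpow_neg (sub_nonneg.2 hy.2.le), div_eq_mul_inv]

theorem integral_one_add_pow_div_sub_rpow {μ x : ℝ} (hμ : μ < 1) (hx : -1 < x) (k : ℕ) :
    ∫ y in (-1 : ℝ)..x, (1 + y) ^ k / (x - y) ^ μ
      = (1 + x) ^ (1 - μ) * (1 + x) ^ k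
        * (k.factorial * Real.Gamma (1 - μ) / Real.Gamma (k + 2 - μ)) := by
  have hc : 0 < 1 + x := by linarith
  have hk : (0 : ℝ) ≤ k := k.cast_nonneg
  have h := integral_rpow_mul_sub_rpow (u := k + 1) (v := 1 - μ) (c := 1 + x) (by linarith)
    (by linarith) hc
  have h2 := intervalIntegral.integral_comp_add_left (a := -1) (b := x)
    (fun y : ℝ => y ^ ((k : ℝ) + 1 - 1) * (1 + x - y) ^ (1 - μ - 1)) 1
  rw [add_neg_cancel, h, Real.Gamma_nat_eq_factorial,
    show (k : ℝ) + 1 + (1 - μ) - 1 = 1 - μ + k by ring,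
    show (k : ℝ) + 1 + (1 - μ) = k + 2 - μ by ring, Real.rpow_add hc, Real.rpow_natCast] at h2
  rw [← h2]
  refine intervalIntegral.integral_congr_Ioo_of_le hx.le fun y hy => ?_
  simp only [add_sub_cancel_right, Real.rpow_natCast, add_sub_add_left_eq_sub]
  rw [show 1 - μ - 1 = -μ by ring, Real.rpow_neg (by linarith [hy.2]), div_eq_mul_inv]

theorem Gamma_add_natCast {s : ℝ} (hs : 0 < s) (n : ℕ) :
    Real.Gamma (s + n) = (ascPochhammer ℝ n).eval s * Real.Gamma s := by
  induction n with
  | zero => simp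
  | succ n ih =>
    have : s + n ≠ 0 := by positivity
    rw [Nat.cast_succ, ← add_assoc, Real.Gamma_add_one this, ih, ascPochhammer_succ_eval]
    ring

/-- The fractional integral of a Legendre polynomial, up to the factor `1 / Γ(1 - μ)`. -/
theorem integral_jacobiPoly_div_sub_rpow {μ x : ℝ} (hμ : μ < 1) (hx : -1 ≤ x) (n : ℕ) :
    ∫ y in (-1 : ℝ)..x, (jacobiPoly 0 0 n).eval y / (x - y) ^ μ
      = Real.Gamma (1 - μ) * ((1 + x) ^ (1 - μ) * (n.factorial / Real.Gamma (n + 2 - μ)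
        * (jacobiPoly (μ - 1) (1 - μ) n).eval x)) := by
  -- At $x=-1$ both sides vanish, the right one since $0^{1-\mu}=0$; the Beta integral needs $x>-1$.
  rcases hx.eq_or_lt with rfl | hx
  · have : 1 - μ ≠ 0 := by linarith
    simp [Real.zero_rpow this]
  simp only [eval_jacobiPoly_eq_sum_one_add, Finset.sum_div]
  rw [intervalIntegral.integral_finsetSum]
  · simp only [mul_div_assoc, intervalIntegral.integral_const_mul]
    simp only [integral_one_add_pow_div_sub_rpow hμ hx, Finset.mul_sum]
    -- The parameters $(0,0)$ and $(\mu-1,1-\mu)$ have the same sum, so $(n+a+b+1)_k$ agrees. The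
    -- Beta factor trades $(k+1)_{n-k}=n!/k!$ for $(k+2-\mu)_{n-k}=\Gamma(n+2-\mu)/\Gamma(k+2-\mu)$.
    refine Finset.sum_congr rfl fun k hk => ?_
    obtain ⟨j, rfl⟩ := Nat.exists_eq_add_of_le (Nat.lt_succ_iff.1 (Finset.mem_range.1 hk))
    have hk0 : (0 : ℝ) ≤ k := k.cast_nonneg
    have h1 := Gamma_add_natCast (s := 0 + k + 1) (by linarith) j
    have h2 := Gamma_add_natCast (s := 1 - μ + k + 1) (by linarith) j
    rw [show (0 : ℝ) + k + 1 + j = ((k + j : ℕ) : ℝ) + 1 by push_cast; ring,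
      Real.Gamma_nat_eq_factorial, zero_add, Real.Gamma_nat_eq_factorial] at h1
    have g1 := (Real.Gamma_pos_of_pos (show 0 < 1 - μ + k + 1 by linarith)).ne'
    have g2 := (ascPochhammer_pos j (1 - μ + k + 1) (by linarith)).ne'
    rw [show ((k + j : ℕ) : ℝ) + 2 - μ = 1 - μ + k + 1 + j by push_cast; ring, h2,
      Nat.add_sub_cancel_left, zero_add, show (k : ℝ) + 2 - μ = 1 - μ + k + 1 by ring, h1,
      show ((k + j : ℕ) : ℝ) + (μ - 1) + (1 - μ) + 1 = (k + j : ℕ) + 0 + 0 + 1 by ring]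
    have g3 : (ascPochhammer ℝ j).eval ((k : ℝ) + 1) ≠ 0 :=
      (ascPochhammer_pos j _ (by linarith)).ne'
    field_simp
  · intro k _
    have := intervalIntegrable_eval_div_sub_rpow hμ hx.le (C ((-1) ^ n * (n.choose k
      * (ascPochhammer ℝ k).eval ((n : ℝ) + 0 + 0 + 1) * (ascPochhammer ℝ (n - k)).eval
      ((0 : ℝ) + k + 1) / n.factorial) * (-(1 / 2)) ^ k) * (1 + X) ^ k)
    simpa only [eval_mul, eval_C, eval_pow, eval_add, eval_one, eval_X] using this

theorem caputoMatrix_apply {N : ℕ} {μ : ℝ} (h0 : 0 < μ) (h1 : μ < 1) (x : Fin (N + 1) → ℝ)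
    (i j : Fin (N + 1)) :
    caputoMatrix μ x i j = 1 / Real.Gamma (1 - μ) *
      ∫ y in (-1 : ℝ)..x i, (derivative (lagrangeBasis x j)).eval y / (x i - y) ^ μ := by
  have hc : ⌈μ⌉₊ = 1 := by
    rw [Nat.ceil_eq_iff one_ne_zero]
    simpa using ⟨h0, h1.le⟩
  simp [caputoMatrix, caputoDeriv, fracIntegral, hc, h1.ne, iteratedDeriv_one]

/-! ### The Legendre case: norms, endpoint values, integration by parts -/

theorem jacobiGamma_zero_zero (n : ℕ) : jacobiGamma 0 0 n = 2 / (2 * n + 1) := by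
  rw [jacobiGamma]
  split_ifs with h
  · subst h
    norm_num [Real.Gamma_two]
  · have : (n.factorial : ℝ) ≠ 0 := by positivity
    simp only [add_zero, zero_add, Real.rpow_one, Real.Gamma_nat_eq_factorial]
    field_simp

theorem eval_one_jacobiPoly_zero_zero (n : ℕ) : (jacobiPoly 0 0 n).eval 1 = 1 := by
  have h : (n.factorial : ℝ) ≠ 0 := by positivity
  simp [eval_jacobiPoly_eq, ← coeff_zero_eq_eval_zero, coeff_jacobiShifted,
    ascPochhammer_eval_one, h]

theorem eval_neg_one_jacobiPoly_zero_zero (n : ℕ) : (jacobiPoly 0 0 n).eval (-1) = (-1) ^ n := by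
  rw [eval_neg_jacobiPoly, eval_one_jacobiPoly_zero_zero, mul_one]

theorem jacobiIntegral_zero_zero (h : (-1 : ℝ) < 0) (p : ℝ[X]) :
    jacobiIntegral h h p = ∫ x in (-1 : ℝ)..1, p.eval x := by
  simp [jacobiIntegral_apply, jacobiWeight]

theorem jacobiIntegral_zero_zero_mul_derivative (h : (-1 : ℝ) < 0) (p q : ℝ[X]) :
    jacobiIntegral h h (p * derivative q)
      = p.eval 1 * q.eval 1 - p.eval (-1) * q.eval (-1) - jacobiIntegral h h (derivative p * q) := by
  simp only [jacobiIntegral_zero_zero, eval_mul]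
  exact intervalIntegral.integral_mul_deriv_eq_deriv_mul (fun x _ => p.hasDerivAt x)
    (fun x _ => q.hasDerivAt x) ((derivative p).continuous.intervalIntegrable _ _)
    ((derivative q).continuous.intervalIntegrable _ _)

/-! ### The two formulas -/

theorem caputoMatrix_eq_sum {m : ℕ} {α β : ℝ} {x : Fin (m + 1 + 1) → ℝ} (hα : -1 < α)
    (hβ : -1 < β) (hx : IsJGLPoints α β x) {μ : ℝ} (h0 : 0 < μ) (h1 : μ < 1)
    (i j : Fin (m + 1 + 1)) :
    caputoMatrix μ x i j = (1 + x i) ^ (1 - μ) * ∑ l ∈ Finset.range (m + 1),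
      (l.factorial / Real.Gamma (l + 2 - μ)) * sCoeff α β x (l + 1) j
        * (jacobiPoly (μ - 1) (1 - μ) l).eval (x i) := by
  have hz : (-1 : ℝ) < 0 := by norm_num
  have hd : (derivative (lagrangeBasis x j)).natDegree < m + 1 := by
    have := natDegree_derivative_le (lagrangeBasis x j)
    rw [natDegree_lagrangeBasis hx.1.injective] at this
    omega
  have hxi : -1 ≤ x i := (abs_le.1 (abs_le_one_of_isJGLPoints hα hβ hx i)).1
  rw [caputoMatrix_apply h0 h1, eq_sum_jacobiPoly hz hz hd]
  simp only [← sCoeff_eq hα hβ hx _ j hz, eval_finsetSum, Finset.sum_div, eval_mul, eval_C,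
    mul_div_assoc]
  rw [intervalIntegral.integral_finsetSum, Finset.mul_sum, Finset.mul_sum]
  · refine Finset.sum_congr rfl fun l _ => ?_
    rw [intervalIntegral.integral_const_mul, integral_jacobiPoly_div_sub_rpow h1 hxi]
    have := (Real.Gamma_pos_of_pos (show 0 < 1 - μ by linarith)).ne'
    field_simp
  · intro l _
    exact (intervalIntegrable_eval_div_sub_rpow h1 hxi _).const_mul _

theorem sCoeff_zero_zero {m : ℕ} {x : Fin (m + 1 + 1) → ℝ} (hx : IsJGLPoints 0 0 x) {l : ℕ}
    (hl : l ≤ m) (j : Fin (m + 1 + 1)) :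
    sCoeff 0 0 x (l + 1) j = 1 / (2 / (2 * (l : ℝ) + 1)) *
      ((if j = Fin.last (m + 1) then 1 else 0) + (-1) ^ (l + 1) * (if j = 0 then 1 else 0)
        - quadratureWeight 0 0 x j * (derivative (jacobiPoly 0 0 l)).eval (x j)) := by
  have hz : (-1 : ℝ) < 0 := by norm_num
  -- This bound puts $P_l'h_j$ within the exactness range, so $\int P_l'h_j$ reduces to the single
  -- term $\omega_jP_l'(x_j)$.
  have hd : (derivative (jacobiPoly 0 0 l) * lagrangeBasis x j).natDegree ≤ 2 * m + 1 := by
    have h1 := natDegree_derivative_le (jacobiPoly 0 0 l)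
    have h2 := natDegree_jacobiPoly_le 0 0 l
    refine natDegree_mul_le.trans ?_
    rw [natDegree_lagrangeBasis hx.1.injective]
    omega
  have h1 : (lagrangeBasis x j).eval 1 = if j = Fin.last (m + 1) then 1 else 0 := by
    have h := eval_lagrangeBasis hx.1.injective (Fin.last (m + 1)) j
    rw [isJGLPoints_last hz hz hx] at h
    simpa only [eq_comm] using h
  have h2 : (lagrangeBasis x j).eval (-1) = if j = 0 then 1 else 0 := by
    have h := eval_lagrangeBasis hx.1.injective 0 j
    rw [isJGLPoints_zero hz hz hx] at h
    simpa only [eq_comm] using h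
  rw [sCoeff_eq hz hz hx l j hz, jacobiGamma_zero_zero, jacobiIntegral_zero_zero_mul_derivative,
    ← sum_quadratureWeight_of_isJGLPoints hz hz hx hd, eval_one_jacobiPoly_zero_zero,
    eval_neg_one_jacobiPoly_zero_zero, h1, h2]
  congr 1
  simp only [eval_mul, eval_lagrangeBasis hx.1.injective, mul_ite, mul_one, mul_zero,
    Finset.sum_ite_eq', Finset.mem_univ, if_true, pow_succ]
  split_ifs <;> ring

theorem theorem3p2 (N : ℕ) (hN : 1 ≤ N) (α β : ℝ) (hα : -1 < α) (hβ : -1 < β)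
    (x : Fin (N + 1) → ℝ) (hx : IsJGLPoints α β x) :
    (∀ μ : ℝ, 0 < μ → μ < 1 → ∀ i j : Fin (N + 1),
      caputoMatrix μ x i j =
        (1 + x i) ^ (1 - μ) * ∑ l ∈ Finset.Icc 1 N,
          ((l - 1).factorial : ℝ) / Real.Gamma ((l : ℝ) + 1 - μ) * sCoeff α β x l j
            * (jacobiPoly (μ - 1) (1 - μ) (l - 1)).eval (x i)) ∧
    (α = 0 → β = 0 → ∀ l ∈ Finset.Icc 1 N, ∀ j : Fin (N + 1),
      sCoeff α β x l j =
        1 / (2 / (2 * (l : ℝ) - 1)) *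
          ((if j = Fin.last N then 1 else 0) + (-1) ^ l * (if j = 0 then 1 else 0)
            - quadratureWeight α β x j
              * (Polynomial.derivative (jacobiPoly 0 0 (l - 1))).eval (x j))) := by
  obtain ⟨m, rfl⟩ : ∃ m, N = m + 1 := ⟨N - 1, by omega⟩
  constructor
  · intro μ h0 h1 i j
    have hI : Finset.Icc 1 (m + 1) = Finset.Ico 1 (m + 1 + 1) := rfl
    rw [caputoMatrix_eq_sum hα hβ hx h0 h1, hI, Finset.sum_Ico_eq_sum_range]
    congr 1
    refine Finset.sum_congr rfl fun l _ => ?_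
    rw [add_comm 1 l, Nat.add_sub_cancel, Nat.cast_succ, add_assoc (l : ℝ), one_add_one_eq_two]
  · rintro rfl rfl l hl j
    obtain ⟨l, rfl⟩ : ∃ k, l = k + 1 := ⟨l - 1, by have := (Finset.mem_Icc.1 hl).1; omega⟩
    rw [sCoeff_zero_zero hx (Nat.succ_le_succ_iff.1 (Finset.mem_Icc.1 hl).2), Nat.add_sub_cancel]
    rw [Nat.cast_succ, show 2 * ((l : ℝ) + 1) - 1 = 2 * l + 1 by ring]
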